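/- Proposition 4.1 (Non-diagonal spiked covariance models). For each $n\ge 1$ let $p=p(n)\ge 1$ and $0\le k=k(n)\le p$ be integers, put $\gamma_n=p/n$, and let $$\Lambda_n=\mathrm{diag}\{\lambda_{n,1},\dots,\lambda_{n,k},1,\dots,1\}\in\mathbb{R}^{p\times p},\qquad \lambda_{n,1},\dots,\lambda_{n,k}>1 .$$ Suppose that $\sup_n\max_{i\le k(n)}\lambda_{n,i}<\infty$ and that $k=o(p)$ as $n\to\infty$. Let $U_n$ be any $p\times p$ real orthogonal matrices. Then the matrices $\Sigma_n=U_n\Lambda_nU_n^{\top}$ have regular eigenvectors in the following sense. Definition (regularity of eigenvectors). Let $\Sigma_n$ be positive semidefinite real $p\times p$ matrices, with any spectral decompositions $\Sigma_n=V_nM_nV_n^{\top}$, where $V_n$ is orthogonal and $M_n$ is diagonal. Let $H_n=p^{-1}\sum_{j=1}^p\delta_{(M_n)_{jj}}$ be the spectral distribution of $\Sigma_n$, and let $t_n(z)=\int\frac{1}{x-z}\,d\mathcal F(H_n,\gamma_n)(x)$, $z\in\mathbb C\setminus\mathbb R$, be the Stieltjes transform of $\mathcal F(H_n,\gamma_n)$.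 Here $\mathcal F$ is the Marčenko–Pastur map: $\mathcal F(H,\gamma)$ is the probability distribution whose Stieltjes transform $t$ satisfies, for all $z$ with $\Im z>0$, $$t(z)=\int\frac{1}{x\{1-\gamma-\gamma z t(z)\}-z}\,dH(x),\qquad \Im\Big\{-\frac{1-\gamma}{z}+\gamma t(z)\Big\}>0 .$$ For $z\in\mathbb C\setminus\mathbb R$ and $\ell\in\{1,2\}$ define $$\Gamma_{n,\ell}(z)=M_n^{1/2}\big[-zI_p+\{(1-\gamma_n)-z\gamma_nt_n(z)\}M_n\big]^{-\ell}M_n^{1/2}.$$ The eigenvectors are regular if the matrix in square brackets is always invertible and, for all fixed $z_1,z_2\in\mathbb C\setminus\mathbb R$ and each $\ell\in\{1,2\}$, as $n\to\infty$, $$\frac1p\sum_{j=1}^p\{V_n\Gamma_{n,\ell}(z_1)V_n^{\top}\}_{jj}\{V_n\Gamma_{n,2}(z_2)V_n^{\top}\}_{jj}=\frac1p\sum_{j=1}^p\{\Gamma_{n,\ell}(z_1)\}_{jj}\{\Gamma_{n,2}(z_2)\}_{jj}+o(1).$$ -/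

import Mathlib

open MeasureTheory Filter Topology

namespace SpikedCovariance

noncomputable section

/-- The Stieltjes transform `z ↦ ∫ 1 / (x - z) dμ(x)` of a measure on the real line. -/
abbrev stieltjesTransform (μ : Measure ℝ) (z : ℂ) : ℂ := resolventTransform μ z

/-- The spectral distribution `H = p⁻¹ ∑ⱼ δ_{Λⱼ}` of a matrix with eigenvalues `Λ₁, …, Λₚ`,
listed with multiplicity. -/
def spectralDistribution {p : ℕ} (Λ : Fin p → ℝ) : Measure ℝ :=
  ENNReal.ofReal (1 / p) • ∑ j, Measure.dirac (Λ j)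

/-- `μ` is the limiting spectral distribution of sample covariance matrices with limiting
population spectral distribution `H` and limiting aspect ratio `γ`: it is the probability
distribution whose Stieltjes transform `t` solves the Marchenko–Pastur equation
`t = ∫ 1 / (x (1 - γ - γ z t) - z) dH(x)` on the upper half-plane, `t = t(z)` being the solution
in the set where `-(1 - γ) / z + γ t` has positive imaginary part. -/
def IsMarchenkoPastur (H : Measure ℝ) (γ : ℝ) (μ : Measure ℝ) : Prop :=
  IsProbabilityMeasure μ ∧
    ∀ z : ℂ, 0 < z.im →
      0 < (-(1 - (γ : ℂ)) / z + γ * stieltjesTransform μ z).im ∧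
      stieltjesTransform μ z =
        ∫ x : ℝ, 1 / ((x : ℂ) * (1 - γ - γ * z * stieltjesTransform μ z) - z) ∂H

open Classical in
/-- The Marchenko–Pastur map `(H, γ) ↦ 𝓕(H, γ)`. By the classical theory, the distribution
described by `IsMarchenkoPastur` exists and is unique whenever `H` is a probability distribution
on `[0, ∞)` and `γ > 0`; the value `0` is a placeholder for other arguments. -/
def marchenkoPasturMap (H : Measure ℝ) (γ : ℝ) : Measure ℝ :=
  if h : ∃ μ : Measure ℝ, IsMarchenkoPastur H γ μ then h.choose else 0

/-- The matrix `-z I + {(1 - γ) - z γ t(z)} Λ`, with `t` the Stieltjes transform of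
`𝓕(H, γ)` and `H` the spectral distribution of `Λ`. -/
def middleFactor {p : ℕ} (γ : ℝ) (Λ : Fin p → ℝ) (z : ℂ) : Matrix (Fin p) (Fin p) ℂ :=
  (-z) • (1 : Matrix (Fin p) (Fin p) ℂ) +
    ((1 - (γ : ℂ)) -
        z * γ * stieltjesTransform (marchenkoPasturMap (spectralDistribution Λ) γ) z) •
      Matrix.diagonal (fun i => (Λ i : ℂ))

/-- The matrix `Γ_ℓ(z) = Λ^{1/2} [-z I + {(1 - γ) - z γ t(z)} Λ]^{-ℓ} Λ^{1/2}`. -/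
def Gam {p : ℕ} (γ : ℝ) (Λ : Fin p → ℝ) (ℓ : ℕ) (z : ℂ) : Matrix (Fin p) (Fin p) ℂ :=
  Matrix.diagonal (fun i => ((√(Λ i) : ℝ) : ℂ)) * (middleFactor γ Λ z)⁻¹ ^ ℓ *
    Matrix.diagonal (fun i => ((√(Λ i) : ℝ) : ℂ))

/-- The matrix `U Γ_ℓ(z) Uᵀ`. -/
def conjGam {p : ℕ} (U : Matrix (Fin p) (Fin p) ℝ) (γ : ℝ) (Λ : Fin p → ℝ) (ℓ : ℕ) (z : ℂ) :
    Matrix (Fin p) (Fin p) ℂ :=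
  U.map (fun x : ℝ => (x : ℂ)) * Gam γ Λ ℓ z * (U.map (fun x : ℝ => (x : ℂ))).transpose

/-- Regularity of eigenvectors of a sequence of `p(n) × p(n)` covariance matrices `Σₙ`, with
aspect ratio `γₙ = p(n) / n`. The condition is required for every spectral decomposition
`Σₙ = Uₙ Λₙ Uₙᵀ`, and includes that the inverses in `Γ_{n,ℓ}(z)` are genuine. -/
def EigenvectorRegularity (p : ℕ → ℕ) (S : ∀ n, Matrix (Fin (p n)) (Fin (p n)) ℝ) : Prop :=
  (∀ n, (S n).PosSemidef) ∧
  ∀ (U : ∀ n, Matrix (Fin (p n)) (Fin (p n)) ℝ) (Λ : ∀ n, Fin (p n) → ℝ),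
    (∀ n, U n ∈ Matrix.orthogonalGroup (Fin (p n)) ℝ) →
    (∀ n, S n = U n * Matrix.diagonal (Λ n) * (U n).transpose) →
    (∀ (n : ℕ) (z : ℂ), z.im ≠ 0 → IsUnit (middleFactor ((p n : ℝ) / n) (Λ n) z)) ∧
    ∀ z₁ z₂ : ℂ, z₁.im ≠ 0 → z₂.im ≠ 0 → ∀ ℓ : ℕ, ℓ = 1 ∨ ℓ = 2 →
      Tendsto (fun n : ℕ =>
        (1 / (p n : ℂ)) * ∑ j, conjGam (U n) ((p n : ℝ) / n) (Λ n) ℓ z₁ j j *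
            conjGam (U n) ((p n : ℝ) / n) (Λ n) 2 z₂ j j -
        (1 / (p n : ℂ)) * ∑ j, Gam ((p n : ℝ) / n) (Λ n) ℓ z₁ j j *
            Gam ((p n : ℝ) / n) (Λ n) 2 z₂ j j) atTop (𝓝 0)

end

end SpikedCovariance

/-! The diagonal of `V Γ Vᵀ` averages the spectral function over the eigenvalues, with weights `V j
i ^ 2` that form a doubly stochastic matrix. All but `k` eigenvalues equal 1, so the spectral
function is constant off `k` indices, and averaging changes the sum of products by at most a
constant times `k` (`norm_sum_conj_diagonal_sub_le`). After division by `p` this is `O(k / p) =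
o(1)`.

The constant is uniform in `n` because the imaginary part of `-z + w x`, with `w` the shrinkage
coefficient and `x ≥ 0`, is at least `|Im z|` in absolute value (`abs_im_le_norm_middle`). This also
gives invertibility. -/

namespace SpikedCovariance

/-! ### Bounds from the Marchenko–Pastur equation -/

/-- The coefficient `(1 - γ) - z γ t(z)` of `Λ` in `middleFactor`. -/
noncomputable def shrinkage {p : ℕ} (γ : ℝ) (Λ : Fin p → ℝ) (z : ℂ) : ℂ :=
  (1 - (γ : ℂ)) - z * γ * stieltjesTransform (marchenkoPasturMap (spectralDistribution Λ) γ) z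

lemma integral_spectralDistribution {p : ℕ} (Λ : Fin p → ℝ) (f : ℝ → ℂ) :
    ∫ x, f x ∂(spectralDistribution Λ) = (1 / p : ℝ) * ∑ j, f (Λ j) := by
  rw [spectralDistribution, integral_smul_measure,
    integral_finsetSum_measure (fun i _ => integrable_dirac (by simp))]
  simp [ENNReal.toReal_ofReal]

lemma stieltjesTransform_conj (μ : Measure ℝ) (z : ℂ) :
    stieltjesTransform μ (starRingEnd ℂ z) = starRingEnd ℂ (stieltjesTransform μ z) := by
  rw [stieltjesTransform, stieltjesTransform, resolventTransform_apply, resolventTransform_apply,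
    ← integral_conj]
  simp [resolvent, Ring.inverse_eq_inv']

/-- The Marchenko–Pastur equation is imposed only for `Im z > 0`; this symmetry carries bounds to
the lower half-plane. -/
lemma shrinkage_conj {p : ℕ} (γ : ℝ) (Λ : Fin p → ℝ) (z : ℂ) :
    shrinkage γ Λ (starRingEnd ℂ z) = starRingEnd ℂ (shrinkage γ Λ z) := by
  simp only [shrinkage, stieltjesTransform_conj]
  simp

/-- If `t` solves the Marchenko–Pastur equation at `z`, then `(1 - γ) - z γ t` has nonpositive
imaginary part. -/
lemma im_shrinkage_nonpos_of_marchenkoPastur {p : ℕ} {γ : ℝ} (hγ : 0 ≤ γ) {Λ : Fin p → ℝ}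
    (hΛ : ∀ i, 0 ≤ Λ i) {z t : ℂ} (hz : 0 < z.im)
    (hs : 0 < (-(1 - (γ : ℂ)) / z + γ * t).im)
    (ht : t = ∫ x : ℝ, 1 / ((x : ℂ) * (1 - γ - γ * z * t) - z) ∂(spectralDistribution Λ)) :
    ((1 - (γ : ℂ)) - z * γ * t).im ≤ 0 := by
  have hz0 : z ≠ 0 := by rintro rfl; simp at hz
  set s : ℂ := -(1 - (γ : ℂ)) / z + γ * t with hsdef
  have hw : 1 - γ - γ * z * t = -(z * s) := by
    rw [hsdef]; field_simp; ring
  rw [integral_spectralDistribution, hw] at ht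
  have hterm : ∀ j, 1 / ((Λ j : ℂ) * -(z * s) - z) = -(1 / z) * (1 + s * Λ j)⁻¹ := by
    intro j
    rw [show (Λ j : ℂ) * -(z * s) - z = -z * (1 + s * Λ j) by ring, one_div, mul_inv, inv_neg,
      one_div]
  simp only [hterm, ← Finset.mul_sum] at ht
  -- In terms of the companion transform `s`, the coefficient is `1 - γ + γ ∫ 1 / (1 + s x) dH(x)`;
  -- since `Im s > 0` and `x ≥ 0`, every summand has nonpositive imaginary part.
  have hw' : (1 - (γ : ℂ)) - z * γ * t =
      ((1 - γ : ℝ) : ℂ) + ((γ * (1 / p) : ℝ) : ℂ) * ∑ j, (1 + s * Λ j)⁻¹ := by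
    rw [ht]; push_cast; field_simp; ring
  rw [hw', Complex.add_im, Complex.ofReal_im, Complex.im_ofReal_mul, Complex.im_sum, zero_add]
  refine mul_nonpos_of_nonneg_of_nonpos (by positivity) (Finset.sum_nonpos fun j _ => ?_)
  rw [Complex.inv_im]
  refine div_nonpos_of_nonpos_of_nonneg ?_ (Complex.normSq_nonneg _)
  simpa using mul_nonneg hs.le (hΛ j)

/-- The coefficient `(1 - γ) - z γ t(z)` maps the upper half-plane to the closed lower half-plane.
This follows from the Marchenko–Pastur equation; for the placeholder value of
`marchenkoPasturMap` the coefficient is the real number `1 - γ`, so that existence of the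
Marchenko–Pastur distribution is not needed. -/
lemma im_shrinkage_nonpos {p : ℕ} {γ : ℝ} (hγ : 0 ≤ γ) {Λ : Fin p → ℝ}
    (hΛ : ∀ i, 0 ≤ Λ i) {z : ℂ} (hz : 0 < z.im) : (shrinkage γ Λ z).im ≤ 0 := by
  rw [shrinkage, marchenkoPasturMap]
  split_ifs with h
  · obtain ⟨hs, ht⟩ := h.choose_spec.2 z hz
    exact im_shrinkage_nonpos_of_marchenkoPastur hγ hΛ hz hs ht
  · simp [stieltjesTransform]

/-- For `Im z > 0` the imaginary parts of `-z` and of `shrinkage γ Λ z * x` are both nonpositive, so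
they cannot cancel. -/
lemma abs_im_le_norm_middle {p : ℕ} {γ : ℝ} (hγ : 0 ≤ γ) {Λ : Fin p → ℝ}
    (hΛ : ∀ i, 0 ≤ Λ i) (z : ℂ) {x : ℝ} (hx : 0 ≤ x) :
    |z.im| ≤ ‖-z + shrinkage γ Λ z * x‖ := by
  have upper : ∀ z : ℂ, 0 < z.im → |z.im| ≤ ‖-z + shrinkage γ Λ z * x‖ := by
    intro z hz
    refine le_trans ?_ (Complex.abs_im_le_norm _)
    have := mul_nonpos_of_nonpos_of_nonneg (im_shrinkage_nonpos hγ hΛ hz) hx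
    rw [Complex.add_im, Complex.neg_im, Complex.im_mul_ofReal, abs_of_pos hz,
      abs_of_neg (by linarith)]
    linarith
  rcases lt_trichotomy z.im 0 with hz | hz | hz
  · have h := upper (starRingEnd ℂ z) (by simpa using hz)
    have e : -(starRingEnd ℂ z) + shrinkage γ Λ (starRingEnd ℂ z) * x =
        starRingEnd ℂ (-z + shrinkage γ Λ z * x) := by
      simp [shrinkage_conj]
    rwa [e, Complex.norm_conj, Complex.conj_im, abs_neg] at h
  · simp [hz]
  · exact upper z hz

/-! ### The matrices as diagonal spectral functions -/

lemma middleFactor_eq_diagonal {p : ℕ} (γ : ℝ) (Λ : Fin p → ℝ) (z : ℂ) :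
    middleFactor γ Λ z = Matrix.diagonal fun i => -z + shrinkage γ Λ z * Λ i := by
  rw [middleFactor, ← shrinkage, Matrix.smul_one_eq_diagonal, ← Matrix.diagonal_smul,
    Matrix.diagonal_add]
  rfl

lemma middle_ne_zero {p : ℕ} {γ : ℝ} (hγ : 0 ≤ γ) {Λ : Fin p → ℝ}
    (hΛ : ∀ i, 0 ≤ Λ i) {z : ℂ} (hz : z.im ≠ 0) {x : ℝ} (hx : 0 ≤ x) :
    -z + shrinkage γ Λ z * x ≠ 0 :=
  norm_pos_iff.mp ((abs_pos.mpr hz).trans_le (abs_im_le_norm_middle hγ hΛ z hx))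

lemma isUnit_middleFactor {p : ℕ} {γ : ℝ} (hγ : 0 ≤ γ) {Λ : Fin p → ℝ}
    (hΛ : ∀ i, 0 ≤ Λ i) {z : ℂ} (hz : z.im ≠ 0) : IsUnit (middleFactor γ Λ z) := by
  rw [middleFactor_eq_diagonal, Matrix.isUnit_diagonal, Pi.isUnit_iff]
  exact fun i => (middle_ne_zero hγ hΛ hz (hΛ i)).isUnit

/-- The value at an eigenvalue `x` of the spectral function defining `Gam`. -/
noncomputable def gamFun {p : ℕ} (γ : ℝ) (Λ : Fin p → ℝ) (ℓ : ℕ) (z : ℂ) (x : ℝ) : ℂ :=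
  x * (-z + shrinkage γ Λ z * x)⁻¹ ^ ℓ

lemma gam_eq_diagonal {p : ℕ} {γ : ℝ} (hγ : 0 ≤ γ) {Λ : Fin p → ℝ}
    (hΛ : ∀ i, 0 ≤ Λ i) (ℓ : ℕ) {z : ℂ} (hz : z.im ≠ 0) :
    Gam γ Λ ℓ z = Matrix.diagonal fun i => gamFun γ Λ ℓ z (Λ i) := by
  have hinv : (middleFactor γ Λ z)⁻¹ =
      Matrix.diagonal fun i => (-z + shrinkage γ Λ z * Λ i)⁻¹ := by
    rw [middleFactor_eq_diagonal]
    refine Matrix.inv_eq_right_inv ?_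
    rw [Matrix.diagonal_mul_diagonal, ← Matrix.diagonal_one]
    congr 1
    funext i
    exact mul_inv_cancel₀ (middle_ne_zero hγ hΛ hz (hΛ i))
  rw [Gam, hinv, Matrix.diagonal_pow, Matrix.diagonal_mul_diagonal, Matrix.diagonal_mul_diagonal]
  congr 1
  funext i
  have hsq : ((√(Λ i) : ℝ) : ℂ) * ((√(Λ i) : ℝ) : ℂ) = Λ i := by
    rw [← Complex.ofReal_mul, Real.mul_self_sqrt (hΛ i)]
  rw [gamFun, ← hsq, Pi.pow_apply, hsq]
  linear_combination ((-z + shrinkage γ Λ z * Λ i)⁻¹ ^ ℓ) * hsq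

lemma norm_gamFun_le {p : ℕ} {γ : ℝ} (hγ : 0 ≤ γ) {Λ : Fin p → ℝ}
    (hΛ : ∀ i, 0 ≤ Λ i) (ℓ : ℕ) {z : ℂ} (hz : z.im ≠ 0) {x C : ℝ} (hx : 0 ≤ x) (hxC : x ≤ C) :
    ‖gamFun γ Λ ℓ z x‖ ≤ C * |z.im|⁻¹ ^ ℓ := by
  rw [gamFun, norm_mul, norm_pow, norm_inv, Complex.norm_real, Real.norm_of_nonneg hx]
  have := abs_im_le_norm_middle hγ hΛ z hx
  have := abs_pos.mpr hz
  gcongr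
  exact hx.trans hxC

/-! ### Averages with squared orthogonal weights -/

section Conjugation

variable {p : ℕ} {V : Matrix (Fin p) (Fin p) ℝ}

lemma conj_diagonal_apply (V : Matrix (Fin p) (Fin p) ℝ) (f : Fin p → ℂ) (j : Fin p) :
    (V.map (fun x : ℝ => (x : ℂ)) * Matrix.diagonal f *
      (V.map (fun x : ℝ => (x : ℂ))).transpose) j j = ∑ i, ((V j i ^ 2 : ℝ) : ℂ) * f i := by
  rw [Matrix.mul_apply]
  refine Finset.sum_congr rfl fun i _ => ?_
  rw [Matrix.mul_diagonal, Matrix.transpose_apply, Matrix.map_apply]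
  push_cast
  ring

lemma row_sq_sum (hV : V ∈ Matrix.orthogonalGroup (Fin p) ℝ) (j : Fin p) :
    ∑ i, V j i ^ 2 = 1 := by
  have h := congrFun (congrFun ((Matrix.mem_orthogonalGroup_iff _ _).mp hV) j) j
  simpa [Matrix.mul_apply, sq] using h

lemma col_sq_sum (hV : V ∈ Matrix.orthogonalGroup (Fin p) ℝ) (i : Fin p) :
    ∑ j, V j i ^ 2 = 1 := by
  have h := congrFun (congrFun ((Matrix.mem_orthogonalGroup_iff' _ _).mp hV) i) i
  simpa [Matrix.mul_apply, sq] using h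

lemma norm_row_average_le (hV : V ∈ Matrix.orthogonalGroup (Fin p) ℝ) {f : Fin p → ℂ} {B : ℝ}
    (hf : ∀ i, ‖f i‖ ≤ B) (j : Fin p) : ‖∑ i, ((V j i ^ 2 : ℝ) : ℂ) * f i‖ ≤ B := by
  calc ‖∑ i, ((V j i ^ 2 : ℝ) : ℂ) * f i‖ ≤ ∑ i, V j i ^ 2 * B := by
        refine norm_sum_le_of_le _ fun i _ => ?_
        rw [norm_mul, Complex.norm_real, Real.norm_of_nonneg (sq_nonneg _)]
        exact mul_le_mul_of_nonneg_left (hf i) (sq_nonneg _)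
    _ = B := by rw [← Finset.sum_mul, row_sq_sum hV, one_mul]

/-- If `f` is constant off `T`, the averages of `f` with weights the squared rows of an orthogonal
matrix deviate from this constant by `O(|T|)` in total. -/
lemma sum_norm_row_average_sub_le (hV : V ∈ Matrix.orthogonalGroup (Fin p) ℝ) {f : Fin p → ℂ}
    {c : ℂ} {B : ℝ} (hf : ∀ i, ‖f i‖ ≤ B) (hc : ‖c‖ ≤ B) {T : Finset (Fin p)}
    (hT : ∀ i ∉ T, f i = c) :
    ∑ j, ‖∑ i, ((V j i ^ 2 : ℝ) : ℂ) * f i - c‖ ≤ 2 * B * T.card := by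
  -- Each row of weights sums to 1, so `c` can be moved inside the average, where only indices in
  -- `T` survive.
  have hsub : ∀ j, ∑ i, ((V j i ^ 2 : ℝ) : ℂ) * f i - c =
      ∑ i ∈ T, ((V j i ^ 2 : ℝ) : ℂ) * (f i - c) := by
    intro j
    have hrow : ∑ i, ((V j i ^ 2 : ℝ) : ℂ) = 1 := by
      rw [← Complex.ofReal_sum, row_sq_sum hV, Complex.ofReal_one]
    rw [Finset.sum_subset (Finset.subset_univ T) fun i _ hi => by rw [hT i hi, sub_self, mul_zero]]
    simp only [mul_sub, Finset.sum_sub_distrib, ← Finset.sum_mul, hrow, one_mul]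
  calc ∑ j, ‖∑ i, ((V j i ^ 2 : ℝ) : ℂ) * f i - c‖
      ≤ ∑ j, ∑ i ∈ T, V j i ^ 2 * (2 * B) := by
        refine Finset.sum_le_sum fun j _ => ?_
        rw [hsub]
        refine norm_sum_le_of_le _ fun i _ => ?_
        rw [norm_mul, Complex.norm_real, Real.norm_of_nonneg (sq_nonneg _)]
        refine mul_le_mul_of_nonneg_left ((norm_sub_le _ _).trans ?_) (sq_nonneg _)
        linarith [hf i]
    _ = 2 * B * T.card := by
        -- Summing over `j` first, each column of weights has total 1, which leaves one `2 * B` per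
        -- element of `T`.
        rw [Finset.sum_comm]
        simp only [← Finset.sum_mul, col_sq_sum hV, one_mul, Finset.sum_const, nsmul_eq_mul]
        ring

lemma norm_sum_row_average_mul_sub_le (hV : V ∈ Matrix.orthogonalGroup (Fin p) ℝ)
    {f g : Fin p → ℂ} {c d : ℂ} {A B : ℝ} (hf : ∀ i, ‖f i‖ ≤ A) (hg : ∀ i, ‖g i‖ ≤ B)
    (hc : ‖c‖ ≤ A) (hd : ‖d‖ ≤ B) {T : Finset (Fin p)}
    (hfT : ∀ i ∉ T, f i = c) (hgT : ∀ i ∉ T, g i = d) :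
    ‖∑ j, (∑ i, ((V j i ^ 2 : ℝ) : ℂ) * f i) * (∑ i, ((V j i ^ 2 : ℝ) : ℂ) * g i) - p * (c * d)‖
      ≤ 4 * A * B * T.card := by
  have hA : 0 ≤ A := (norm_nonneg c).trans hc
  have hB : 0 ≤ B := (norm_nonneg d).trans hd
  have e : (p : ℂ) * (c * d) = ∑ _j : Fin p, c * d := by simp
  rw [e, ← Finset.sum_sub_distrib]
  calc _ ≤ ∑ j, (‖∑ i, ((V j i ^ 2 : ℝ) : ℂ) * f i - c‖ * B +
          A * ‖∑ i, ((V j i ^ 2 : ℝ) : ℂ) * g i - d‖) := by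
        refine norm_sum_le_of_le _ fun j _ => ?_
        set a := ∑ i, ((V j i ^ 2 : ℝ) : ℂ) * f i
        have hb := norm_row_average_le hV hg j
        set b := ∑ i, ((V j i ^ 2 : ℝ) : ℂ) * g i
        rw [show a * b - c * d = (a - c) * b + c * (b - d) by ring]
        refine (norm_add_le _ _).trans ?_
        rw [norm_mul, norm_mul]
        gcongr
    _ ≤ 2 * A * T.card * B + A * (2 * B * T.card) := by
        rw [Finset.sum_add_distrib, ← Finset.sum_mul, ← Finset.mul_sum]
        gcongr
        · exact sum_norm_row_average_sub_le hV hf hc hfT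
        · exact sum_norm_row_average_sub_le hV hg hd hgT
    _ = 4 * A * B * T.card := by ring

lemma norm_sum_conj_diagonal_sub_le (hV : V ∈ Matrix.orthogonalGroup (Fin p) ℝ)
    {f g : Fin p → ℂ} {c d : ℂ} {A B : ℝ} (hf : ∀ i, ‖f i‖ ≤ A) (hg : ∀ i, ‖g i‖ ≤ B)
    (hc : ‖c‖ ≤ A) (hd : ‖d‖ ≤ B) {T : Finset (Fin p)}
    (hfT : ∀ i ∉ T, f i = c) (hgT : ∀ i ∉ T, g i = d) :
    ‖∑ j, (∑ i, ((V j i ^ 2 : ℝ) : ℂ) * f i) * (∑ i, ((V j i ^ 2 : ℝ) : ℂ) * g i) -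
      ∑ j, f j * g j‖ ≤ 8 * A * B * T.card := by
  have h₁ := norm_sum_row_average_mul_sub_le hV hf hg hc hd hfT hgT
  -- With the identity as orthogonal matrix the averages are `f j` and `g j` themselves; both sums
  -- are then compared with `p * (c * d)`, whence `8 = 4 + 4`.
  have h₂ := norm_sum_row_average_mul_sub_le (one_mem (Matrix.orthogonalGroup (Fin p) ℝ))
    hf hg hc hd hfT hgT
  have e : ∀ (h : Fin p → ℂ) (j : Fin p),
      ∑ i, (((1 : Matrix (Fin p) (Fin p) ℝ) j i ^ 2 : ℝ) : ℂ) * h i = h j := by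
    intro h j
    rw [Finset.sum_eq_single j (fun i _ hi => by simp [Matrix.one_apply_ne' hi]) (by simp)]
    simp
  simp only [e] at h₂
  have := norm_sub_le_norm_sub_add_norm_sub
    (∑ j, (∑ i, ((V j i ^ 2 : ℝ) : ℂ) * f i) * (∑ i, ((V j i ^ 2 : ℝ) : ℂ) * g i))
    (p * (c * d)) (∑ j, f j * g j)
  rw [norm_sub_rev ((p : ℂ) * (c * d))] at this
  linarith

/-! ### Independence of the spectral decomposition -/

lemma charpoly_conj_diagonal (hV : V ∈ Matrix.orthogonalGroup (Fin p) ℝ) (M : Fin p → ℝ) :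
    (V * Matrix.diagonal M * V.transpose).charpoly =
      ∏ i, (Polynomial.X - Polynomial.C (M i)) := by
  rw [Matrix.charpoly_mul_comm, ← mul_assoc, (Matrix.mem_orthogonalGroup_iff' _ _).mp hV, one_mul,
    Matrix.charpoly_diagonal]

/-- The eigenvalues in two spectral decompositions of a matrix agree with multiplicities. -/
lemma map_eigenvalues_eq {W : Matrix (Fin p) (Fin p) ℝ}
    (hV : V ∈ Matrix.orthogonalGroup (Fin p) ℝ) (hW : W ∈ Matrix.orthogonalGroup (Fin p) ℝ)
    {M N : Fin p → ℝ}
    (h : V * Matrix.diagonal M * V.transpose = W * Matrix.diagonal N * W.transpose) :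
    Finset.univ.val.map M = Finset.univ.val.map N := by
  have hroots : ∀ L : Fin p → ℝ, (∏ i, (Polynomial.X - Polynomial.C (L i))).roots =
      Finset.univ.val.map L := fun L => by
    rw [← Polynomial.roots_multiset_prod_X_sub_C (Finset.univ.val.map L), Multiset.map_map]
    rfl
  rw [← hroots M, ← hroots N, ← charpoly_conj_diagonal hV, ← charpoly_conj_diagonal hW, h]

end Conjugation

/-- A spectral decomposition of `U Λ Uᵀ`, where `Λ` has at most `k` entries other than `1`, has at
most `k` eigenvalues other than `1`. -/
lemma card_filter_ne_one_le {p k : ℕ} {Λ M : Fin p → ℝ}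
    (hone : ∀ i : Fin p, k ≤ (i : ℕ) → Λ i = 1)
    (h : Finset.univ.val.map M = Finset.univ.val.map Λ) :
    (Finset.univ.filter fun i => M i ≠ 1).card ≤ k := by
  have hcount : ∀ L : Fin p → ℝ, (Finset.univ.filter fun i => L i ≠ 1).card =
      (Finset.univ.val.map L).countP (· ≠ 1) := fun L => by
    rw [Multiset.countP_map]; rfl
  rw [hcount, h, ← hcount]
  calc (Finset.univ.filter fun i => Λ i ≠ 1).card ≤ (Finset.range k).card := by
        refine Finset.card_le_card_of_injOn Fin.val (fun i hi => ?_) Fin.val_injective.injOn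
        simp only [Finset.coe_filter, Finset.mem_univ, true_and, Set.mem_ofPred_eq] at hi
        simpa using lt_of_not_ge fun hk => hi (hone i hk)
    _ = k := Finset.card_range k

/-! ### The quantitative bound and the theorem -/

lemma norm_regularity_sub_le {p k : ℕ} {γ : ℝ} (hγ : 0 ≤ γ)
    {V : Matrix (Fin p) (Fin p) ℝ} (hV : V ∈ Matrix.orthogonalGroup (Fin p) ℝ)
    {M : Fin p → ℝ} {C : ℝ} (hC : 1 ≤ C) (hM : ∀ i, 0 ≤ M i) (hMC : ∀ i, M i ≤ C)
    (hcard : (Finset.univ.filter fun i => M i ≠ 1).card ≤ k)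
    {z₁ z₂ : ℂ} (hz₁ : z₁.im ≠ 0) (hz₂ : z₂.im ≠ 0) (ℓ m : ℕ) :
    ‖(1 / (p : ℂ)) * ∑ j, conjGam V γ M ℓ z₁ j j * conjGam V γ M m z₂ j j -
      (1 / (p : ℂ)) * ∑ j, Gam γ M ℓ z₁ j j * Gam γ M m z₂ j j‖ ≤
    8 * (C * |z₁.im|⁻¹ ^ ℓ) * (C * |z₂.im|⁻¹ ^ m) * (k / p) := by
  simp only [conjGam, gam_eq_diagonal hγ hM _ hz₁, gam_eq_diagonal hγ hM _ hz₂,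
    conj_diagonal_apply, Matrix.diagonal_apply_eq]
  rw [← mul_sub, norm_mul, norm_div, norm_one, Complex.norm_natCast]
  -- The constants `c` and `d` are the spectral functions at eigenvalue 1; `1 ≤ C` makes them obey
  -- the same bounds even if 1 is not an eigenvalue.
  have hone : ∀ i ∉ Finset.univ.filter (fun i => M i ≠ 1), M i = 1 := fun i hi => by simpa using hi
  have hbound := norm_sum_conj_diagonal_sub_le hV
    (f := fun i => gamFun γ M ℓ z₁ (M i)) (g := fun i => gamFun γ M m z₂ (M i))
    (fun i => norm_gamFun_le hγ hM ℓ hz₁ (hM i) (hMC i))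
    (fun i => norm_gamFun_le hγ hM m hz₂ (hM i) (hMC i))
    (norm_gamFun_le hγ hM ℓ hz₁ zero_le_one hC) (norm_gamFun_le hγ hM m hz₂ zero_le_one hC)
    (fun i hi => by rw [hone i hi]) (fun i hi => by rw [hone i hi])
  calc _ ≤ 1 / (p : ℝ) * (8 * (C * |z₁.im|⁻¹ ^ ℓ) * (C * |z₂.im|⁻¹ ^ m) *
        (Finset.univ.filter fun i => M i ≠ 1).card) := by gcongr
    _ ≤ 1 / (p : ℝ) * (8 * (C * |z₁.im|⁻¹ ^ ℓ) * (C * |z₂.im|⁻¹ ^ m) * k) := by gcongr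
    _ = _ := by ring

end SpikedCovariance

open SpikedCovariance in
theorem proposition4p1 (p k : ℕ → ℕ) (hkp : ∀ n, k n ≤ p n)
    (Λ : ∀ n, Fin (p n) → ℝ)
    (hspike : ∀ (n : ℕ) (i : Fin (p n)), (i : ℕ) < k n → 1 < Λ n i)
    (hone : ∀ (n : ℕ) (i : Fin (p n)), k n ≤ (i : ℕ) → Λ n i = 1)
    (hbdd : ∃ C : ℝ, ∀ (n : ℕ) (i : Fin (p n)), Λ n i ≤ C)
    (hk : (fun n => (k n : ℝ)) =o[atTop] (fun n => (p n : ℝ)))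
    (U : ∀ n, Matrix (Fin (p n)) (Fin (p n)) ℝ)
    (hU : ∀ n, U n ∈ Matrix.orthogonalGroup (Fin (p n)) ℝ) :
    SpikedCovariance.EigenvectorRegularity p
      (fun n => U n * Matrix.diagonal (Λ n) * (U n).transpose) := by
  obtain ⟨C, hC⟩ := hbdd
  have hΛ : ∀ n i, 0 ≤ Λ n i := fun n i => by
    rcases lt_or_ge (i : ℕ) (k n) with h | h
    · exact zero_le_one.trans (hspike n i h).le
    · rw [hone n i h]; exact zero_le_one
  refine ⟨fun n => ?_, fun V M hV hM => ?_⟩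
  · have h := (Matrix.PosSemidef.diagonal (hΛ n)).mul_mul_conjTranspose_same (U n)
    rwa [Matrix.conjTranspose_eq_transpose_of_trivial] at h
  have hmap : ∀ n, Finset.univ.val.map (M n) = Finset.univ.val.map (Λ n) := fun n =>
    (map_eigenvalues_eq (hU n) (hV n) (hM n)).symm
  have hmem : ∀ n i, ∃ j, Λ n j = M n i := fun n i => by
    have h : M n i ∈ Finset.univ.val.map (Λ n) :=
      hmap n ▸ Multiset.mem_map_of_mem _ (Finset.mem_univ i)
    simpa using h
  have hM0 : ∀ n i, 0 ≤ M n i := fun n i => by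
    obtain ⟨j, hj⟩ := hmem n i
    exact hj ▸ hΛ n j
  have hMC : ∀ n i, M n i ≤ max C 1 := fun n i => by
    obtain ⟨j, hj⟩ := hmem n i
    exact hj ▸ (hC n j).trans (le_max_left _ _)
  -- At `n = 0` the quotient is 0 by convention, so the bound holds there too.
  have hγ : ∀ n : ℕ, 0 ≤ (p n : ℝ) / n := fun n => by positivity
  refine ⟨fun n z hz => isUnit_middleFactor (hγ n) (hM0 n) hz, fun z₁ z₂ hz₁ hz₂ ℓ _ => ?_⟩
  refine squeeze_zero_norm (fun n => norm_regularity_sub_le (hγ n) (hV n) (le_max_right C 1)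
    (hM0 n) (hMC n) (card_filter_ne_one_le (hone n) (hmap n)) hz₁ hz₂ ℓ 2) ?_
  simpa only [mul_zero] using hk.tendsto_div_nhds_zero.const_mul
    (8 * (max C 1 * |z₁.im|⁻¹ ^ ℓ) * (max C 1 * |z₂.im|⁻¹ ^ 2))
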